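/- Let $n$ be a positive integer. A lattice is $n$-distributive if it satisfies the identity $$x\wedge\bigvee_{0\le i\le n}y_i=\bigvee_{0\le i\le n}\Bigl(x\wedge\bigvee_{0\le j\le n,\ j\ne i}y_j\Bigr).$$ Let $\mathcal D_n$ be the class of all $n$-distributive lattices; it is a variety, that is, the class of all lattices satisfying some set of lattice identities. Then: (1) $\mathcal D_n$ is generated by its finite members, that is, $\mathcal D_n$ is the smallest variety of lattices that contains all finite $n$-distributive lattices. (2) Consequently, the word problem for free lattices in $\mathcal D_n$ is decidable: for every finite or countably infinite set $X$ (given with an effective coding of its elements by natural numbers), there is an algorithm that decides, given two lattice terms $s$ and $t$ with variables in $X$, whether $s$ and $t$ represent the same element of the free lattice on $X$ in the variety $\mathcal D_n$. -/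

import Mathlib

universe u v

/-! ## Lattice terms, identities, varieties -/

/-- Lattice terms with variables in `X`. -/
inductive LatticeTerm (X : Type u) : Type u
  | var : X → LatticeTerm X
  | sup : LatticeTerm X → LatticeTerm X → LatticeTerm X
  | inf : LatticeTerm X → LatticeTerm X → LatticeTerm X

/-- The value of a lattice term in a lattice `L` under an assignment of the variables. -/
def LatticeTerm.eval {X : Type u} {L : Type v} [Lattice L] (a : X → L) : LatticeTerm X → L
  | .var x => a x
  | .sup s t => s.eval a ⊔ t.eval a
  | .inf s t => s.eval a ⊓ t.eval a

/-- The lattice `L` satisfies the identity `s = t`. -/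
def SatisfiesIdentity (L : Type u) [Lattice L] (s t : LatticeTerm ℕ) : Prop :=
  ∀ a : ℕ → L, s.eval a = t.eval a

/-- A class of lattices (in a fixed universe). -/
abbrev LatticeClass : Type (u + 1) := ∀ (L : Type u) [Lattice L], Prop

/-- A class of lattices is a variety if it is the class of all lattices that satisfy some set
of identities. -/
def IsLatticeVariety (V : LatticeClass.{u}) : Prop :=
  ∃ E : Set (LatticeTerm ℕ × LatticeTerm ℕ),
    ∀ (L : Type u) [Lattice L], V L ↔ ∀ e ∈ E, SatisfiesIdentity L e.1 e.2

/-- `V` is the variety generated by the class `K`: the smallest variety that contains `K`. -/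
def IsVarietyGeneratedBy (V K : LatticeClass.{u}) : Prop :=
  IsLatticeVariety V ∧
    (∀ (L : Type u) [Lattice L], K L → V L) ∧
    ∀ W : LatticeClass.{u}, IsLatticeVariety W →
      (∀ (L : Type u) [Lattice L], K L → W L) → ∀ (L : Type u) [Lattice L], V L → W L

/-! ## `n`-distributivity -/

theorem erase_univ_nonempty {n : ℕ} (hn : 0 < n) (i : Fin (n + 1)) :
    ((Finset.univ : Finset (Fin (n + 1))).erase i).Nonempty := by
  rw [← Finset.card_pos, Finset.card_erase_of_mem (Finset.mem_univ i), Finset.card_univ,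
    Fintype.card_fin]
  simpa using hn

/-- A lattice is `n`-distributive, for a positive integer `n`, if it satisfies the identity
`x ⊓ ⨆ i, y i = ⨆ i, (x ⊓ ⨆ j ≠ i, y j)`, where `i` and `j` range over `0, …, n`. -/
def IsNDistributive (n : ℕ) (hn : 0 < n) (L : Type u) [Lattice L] : Prop :=
  ∀ (x : L) (y : Fin (n + 1) → L),
    x ⊓ Finset.univ.sup' Finset.univ_nonempty y =
      Finset.univ.sup' Finset.univ_nonempty
        fun i => x ⊓ (Finset.univ.erase i).sup' (erase_univ_nonempty hn i) y

/-! ## Free lattices in the variety of `n`-distributive lattices -/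

/-- Two terms over `X` are identified if they take the same value in every `n`-distributive
lattice under every assignment. -/
def nDistrSetoid (n : ℕ) (hn : 0 < n) (X : Type u) : Setoid (LatticeTerm X) where
  r s t := ∀ (L : Type u) [Lattice L], IsNDistributive n hn L → ∀ a : X → L, s.eval a = t.eval a
  iseqv :=
    { refl := fun _ _ _ _ _ => rfl
      symm := fun h L _ hL a => (h L hL a).symm
      trans := fun h₁ h₂ L _ hL a => (h₁ L hL a).trans (h₂ L hL a) }

/-- The free lattice on the set `X` of generators in the variety of all `n`-distributive
lattices. -/
def FreeNDistrLattice (n : ℕ) (hn : 0 < n) (X : Type u) : Type u :=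
  Quotient (nDistrSetoid n hn X)

namespace FreeNDistrLattice

variable {n : ℕ} {hn : 0 < n} {X : Type u}

/-- The element of the free lattice that a term represents. -/
def mk (t : LatticeTerm X) : FreeNDistrLattice n hn X := Quotient.mk (nDistrSetoid n hn X) t

theorem mk_eq_mk {s t : LatticeTerm X} :
    (mk s : FreeNDistrLattice n hn X) = mk t ↔
      ∀ (L : Type u) [Lattice L], IsNDistributive n hn L →
        ∀ a : X → L, s.eval a = t.eval a :=
  Quotient.eq (r := nDistrSetoid n hn X)

theorem ind {p : FreeNDistrLattice n hn X → Prop} (h : ∀ t, p (mk t)) (a) : p a :=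
  Quotient.ind h a

instance : Max (FreeNDistrLattice n hn X) where
  max := Quotient.map₂ LatticeTerm.sup fun _ _ h₁ _ _ h₂ L _ hL a => by
    simp only [LatticeTerm.eval, h₁ L hL a, h₂ L hL a]

instance : Min (FreeNDistrLattice n hn X) where
  min := Quotient.map₂ LatticeTerm.inf fun _ _ h₁ _ _ h₂ L _ hL a => by
    simp only [LatticeTerm.eval, h₁ L hL a, h₂ L hL a]

instance : Lattice (FreeNDistrLattice n hn X) :=
  Lattice.mk'
    (fun a b => by
      induction a using ind; induction b using ind
      exact mk_eq_mk.2 fun L _ _ a => sup_comm _ _)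
    (fun a b c => by
      induction a using ind; induction b using ind; induction c using ind
      exact mk_eq_mk.2 fun L _ _ a => sup_assoc _ _ _)
    (fun a b => by
      induction a using ind; induction b using ind
      exact mk_eq_mk.2 fun L _ _ a => inf_comm _ _)
    (fun a b c => by
      induction a using ind; induction b using ind; induction c using ind
      exact mk_eq_mk.2 fun L _ _ a => inf_assoc _ _ _)
    (fun a b => by
      induction a using ind; induction b using ind
      exact mk_eq_mk.2 fun L _ _ a => sup_inf_self)
    (fun a b => by
      induction a using ind; induction b using ind
      exact mk_eq_mk.2 fun L _ _ a => inf_sup_self)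

/-- The canonical map from the generators to the free lattice. -/
def of (x : X) : FreeNDistrLattice n hn X := mk (.var x)

theorem eval_of (t : LatticeTerm X) :
    t.eval (of : X → FreeNDistrLattice n hn X) = mk t := by
  induction t with
  | var x => rfl
  | sup s t hs ht => simp only [LatticeTerm.eval, hs, ht]; rfl
  | inf s t hs ht => simp only [LatticeTerm.eval, hs, ht]; rfl

/-- The homomorphism that extends a map from the generators to an `n`-distributive lattice. -/
def lift {L : Type u} [Lattice L] (hL : IsNDistributive n hn L) (a : X → L) :
    LatticeHom (FreeNDistrLattice n hn X) L where
  toFun := Quotient.lift (fun t => t.eval a) fun _ _ h => h L hL a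
  map_sup' x y := by
    induction x using ind; induction y using ind; rfl
  map_inf' x y := by
    induction x using ind; induction y using ind; rfl

theorem isNDistributive : IsNDistributive n hn (FreeNDistrLattice n hn X) := by
  have key : ∀ x y : FreeNDistrLattice n hn X,
      (∀ (L : Type u) [Lattice L] (hL : IsNDistributive n hn L) (a : X → L),
        lift hL a x = lift hL a y) → x = y := by
    intro x y h
    induction x using ind; induction y using ind
    exact mk_eq_mk.2 fun L _ hL a => h L hL a
  intro x y
  refine key _ _ fun L _ hL a => ?_
  simp only [map_inf, map_finset_sup', Function.comp_def]
  exact hL _ _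

theorem existsUnique_hom {L : Type u} [Lattice L] (hL : IsNDistributive n hn L) (a : X → L) :
    ∃! f : LatticeHom (FreeNDistrLattice n hn X) L, ∀ x, f (of x) = a x := by
  refine ⟨lift hL a, fun _ => rfl, fun f hf => ?_⟩
  ext x
  induction x using ind with
  | h t =>
    rw [← eval_of]
    induction t with
    | var x => exact hf x
    | sup s t hs ht => simp only [LatticeTerm.eval, map_sup, hs, ht]
    | inf s t hs ht => simp only [LatticeTerm.eval, map_inf, hs, ht]

end FreeNDistrLattice

/-! ## Terms as inputs of algorithms: a Gödel numbering of terms -/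

namespace LatticeTerm

variable {X : Type u}

/-- The code of a term. -/
def toCode [Encodable X] : LatticeTerm X → ℕ
  | .var x => 3 * Encodable.encode x
  | .sup s t => 3 * Nat.pair s.toCode t.toCode + 1
  | .inf s t => 3 * Nat.pair s.toCode t.toCode + 2

/-- The term with a given code, if there is one. -/
def ofCode [Encodable X] (m : ℕ) : Option (LatticeTerm X) :=
  if h : m % 3 = 0 then (Encodable.decode (m / 3)).map .var
  else
    have h₁ : (m / 3).unpair.1 < m :=
      lt_of_le_of_lt (Nat.unpair_left_le _) (by omega)
    have h₂ : (m / 3).unpair.2 < m :=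
      lt_of_le_of_lt (Nat.unpair_right_le _) (by omega)
    (ofCode (m / 3).unpair.1).bind fun s => (ofCode (m / 3).unpair.2).map fun t =>
      if m % 3 = 1 then .sup s t else .inf s t
termination_by m

theorem ofCode_toCode [Encodable X] (t : LatticeTerm X) : ofCode t.toCode = some t := by
  induction t with
  | var x =>
    rw [ofCode]; simp [toCode]
  | sup s t hs ht =>
    have e : (3 * Nat.pair s.toCode t.toCode + 1) / 3 = Nat.pair s.toCode t.toCode := by omega
    have e' : (3 * Nat.pair s.toCode t.toCode + 1) % 3 = 1 := by omega
    rw [ofCode]; simp [toCode, e, e', hs, ht]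
  | inf s t hs ht =>
    have e : (3 * Nat.pair s.toCode t.toCode + 2) / 3 = Nat.pair s.toCode t.toCode := by omega
    have e' : (3 * Nat.pair s.toCode t.toCode + 2) % 3 = 2 := by omega
    rw [ofCode]; simp [toCode, e, e', hs, ht]

instance [Encodable X] : Encodable (LatticeTerm X) where
  encode := toCode
  decode := ofCode
  encodek := ofCode_toCode

theorem primrec_map_ofCode [Primcodable X] :
    Primrec fun m : ℕ => (ofCode m : Option (LatticeTerm X)).map toCode := by
  let g : List (Option ℕ) → Option (Option ℕ) := fun l =>
    some (if l.length % 3 = 0 then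
      (Encodable.decode (α := X) (l.length / 3)).map fun x => 3 * Encodable.encode x
    else
      (l[(l.length / 3).unpair.1]?.getD none).bind fun s =>
        (l[(l.length / 3).unpair.2]?.getD none).map fun t =>
          if l.length % 3 = 1 then 3 * Nat.pair s t + 1 else 3 * Nat.pair s t + 2)
  have hlen : Primrec fun l : List (Option ℕ) => l.length := Primrec.list_length
  have hmod : Primrec fun l : List (Option ℕ) => l.length % 3 :=
    Primrec.nat_mod.comp hlen (Primrec.const 3)
  have hdiv : Primrec fun l : List (Option ℕ) => l.length / 3 :=
    Primrec.nat_div.comp hlen (Primrec.const 3)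
  have hp := Primrec.unpair.comp hdiv
  have hget : ∀ {i : List (Option ℕ) → ℕ}, Primrec i →
      Primrec fun l : List (Option ℕ) => l[i l]?.getD none := fun hi =>
    Primrec.option_getD.comp (Primrec.list_getElem?.comp Primrec.id hi) (Primrec.const none)
  have h3 : Primrec fun k : ℕ => 3 * k := Primrec.nat_mul.comp (Primrec.const 3) Primrec.id
  have hg : Primrec g := by
    refine Primrec.option_some.comp
      (Primrec.ite (Primrec.eq.comp hmod (Primrec.const 0)) ?_ ?_)
    · exact Primrec.option_map (Primrec.decode.comp hdiv)
        ((h3.comp (Primrec.encode.comp Primrec.snd)).to₂)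
    · refine Primrec.option_bind (hget (Primrec.fst.comp hp)) ?_
      refine Primrec.option_map ((hget (Primrec.snd.comp hp)).comp Primrec.fst) ?_
      have hpair : Primrec fun q : (List (Option ℕ) × ℕ) × ℕ => 3 * Nat.pair q.1.2 q.2 :=
        h3.comp (Primrec₂.natPair.comp (Primrec.snd.comp Primrec.fst) Primrec.snd)
      exact Primrec.ite
        (Primrec.eq.comp (hmod.comp (Primrec.fst.comp Primrec.fst)) (Primrec.const 1))
        (Primrec.succ.comp hpair) (Primrec.succ.comp (Primrec.succ.comp hpair))
  have main := Primrec.nat_strong_rec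
    (fun (_ : Unit) (m : ℕ) => (ofCode m : Option (LatticeTerm X)).map toCode)
    (g := fun _ l => g l) (hg.comp Primrec.snd) (by
      intro _ m
      simp only [g, List.length_map, List.length_range, Option.some.injEq]
      rw [ofCode]
      by_cases h : m % 3 = 0
      · simp [h, Function.comp_def, toCode]
      · have h₁ : (m / 3).unpair.1 < m :=
          lt_of_le_of_lt (Nat.unpair_left_le _) (by omega)
        have h₂ : (m / 3).unpair.2 < m :=
          lt_of_le_of_lt (Nat.unpair_right_le _) (by omega)
        simp only [h, if_false, dif_neg, not_false_eq_true, List.getElem?_map,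
          List.getElem?_range h₁, List.getElem?_range h₂, Option.map_some, Option.getD_some]
        cases (ofCode (m / 3).unpair.1 : Option (LatticeTerm X)) <;>
          cases (ofCode (m / 3).unpair.2 : Option (LatticeTerm X)) <;>
          simp
        split_ifs <;> simp [toCode])
  exact main.comp (Primrec.const ()) Primrec.id

instance [Primcodable X] : Primcodable (LatticeTerm X) where
  prim := by
    refine Primrec.nat_iff.1 ((Primrec.encode.comp (primrec_map_ofCode (X := X))).of_eq
      fun m => ?_)
    change _ = Encodable.encode (ofCode m : Option (LatticeTerm X))
    cases (ofCode m : Option (LatticeTerm X)) <;> rfl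

end LatticeTerm

/-- The word problem for the free lattice on `X` in the variety of all `n`-distributive lattices
is decidable: there is an algorithm that decides, for two lattice terms in the generators,
whether they represent the same element of that free lattice. -/
def DecidableWordProblem (n : ℕ) (hn : 0 < n) (X : Type u) [Primcodable X] : Prop :=
  ComputablePred fun p : LatticeTerm X × LatticeTerm X =>
    p.1.eval (FreeNDistrLattice.of : X → FreeNDistrLattice n hn X) =
      p.2.eval (FreeNDistrLattice.of : X → FreeNDistrLattice n hn X)

/-!
An inequality `s ≤ t` between lattice terms that fails in an `n`-distributive lattice `L` already
fails in a finite `n`-distributive lattice whose size is bounded in terms of `n` and `s`. This gives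
both parts: a variety that contains the finite `n`-distributive lattices contains all of them, and
the equality of two terms is decided by a search through all finite lattices up to the bound.

Order the filters of `L` by reverse inclusion. By Zorn's lemma the irreducible filters separate the
elements of `L` (`exists_isIrreducibleFilter`), and `n`-distributivity means for them that every
finite cover of an irreducible filter contains a cover by at most `n` of its members
(`IsNDistributive.exists_subcover`). If `a ⊔ b` lies in an irreducible filter `p` that contains
neither `a` nor `b`, then `p` is covered by at most `n` irreducible filters each of which contains
`a` or `b` (`IsNDistributive.exists_irreducible_cover`): an irredundant cover of the largest
possible size, with its members enlarged as far as possible, consists of irreducible filters, since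
a reducible member could be split in two.

Now fix a valuation with `s ≰ t` and an irreducible filter `p` that contains the value of `s` but
not that of `t`. Descending through the subterms of `s` and choosing such a cover at every join
collects a finite set `Q` of irreducible filters (`IsNDistributive.exists_finset_mem_eval`). The
relation "`q` is covered by `A`" is a closure operator on `Q` in which closures are determined by
sets of at most `n` elements; for such an operator the lattice of closed sets is `n`-distributive
(`ClosureOperator.isNDistributive_closeds`). In it, `p` belongs to the value of `s` by the choice of
`Q`, and not to the value of `t`, because values of terms in closed sets are never larger than those
in `L` (`evalFilters_le_filtersContaining`).

For the decision procedure, `n`-distributivity is a single identity, the operations of a finite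
algebra and the values of the variables are coded as numerals in base `m`, where `m` is the size
of the algebra, and evaluation of terms is primitive recursive in these codes.
-/

universe w

/-! ### Irreducible filters and their covers -/

section Filters

variable {L : Type u} [Lattice L]

/-- A filter of a lattice, as a set: an upper set closed under binary meets. The empty set is
allowed. -/
structure IsLatticeFilter (F : Set L) : Prop where
  upper : ∀ {x y}, x ∈ F → x ≤ y → y ∈ F
  inf_mem : ∀ {x y}, x ∈ F → y ∈ F → x ⊓ y ∈ F

/-- A proper filter that is not the intersection of two larger filters, stated elementwise: if
`c` and `d` are not in `p`, then the filters generated by `p` with `c` and by `p` with `d` have a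
common element outside `p`. Under reverse inclusion these are the join-irreducible elements of the
lattice of filters. -/
structure IsIrreducibleFilter (p : Set L) : Prop extends IsLatticeFilter p where
  ne_univ : p ≠ Set.univ
  exists_inf_le : ∀ {c d}, c ∉ p → d ∉ p → ∃ x ∈ p, ∃ z ∉ p, x ⊓ c ≤ z ∧ x ⊓ d ≤ z

/-- The family `q` of filters covers `p`: in the lattice of filters under reverse inclusion, `p`
lies below the join of the `q i`. -/
def FilterCover {ι : Type*} (q : ι → Set L) (p : Set L) : Prop :=
  ∀ x, (∀ i, x ∈ q i) → x ∈ p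

/-- No member of the family `q` can be left out of a cover of `p`: each leaves behind a witness
outside `p`. -/
def FilterIrredundant {ι : Type*} (q : ι → Set L) (p : Set L) : Prop :=
  ∀ i, ∃ c ∉ p, ∀ j, j ≠ i → c ∈ q j

theorem isLatticeFilter_Ici (a : L) : IsLatticeFilter (Set.Ici a) where
  upper h h' := le_trans h h'
  inf_mem h h' := le_inf h h'

/-- The filter generated by the filter `F` and the element `c`, if `F` is nonempty. -/
def filterAdjoin (F : Set L) (c : L) : Set L := {z | ∃ x ∈ F, x ⊓ c ≤ z}

theorem isLatticeFilter_filterAdjoin {F : Set L} (hF : IsLatticeFilter F) (c : L) :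
    IsLatticeFilter (filterAdjoin F c) where
  upper := fun ⟨x, hx, h⟩ h' => ⟨x, hx, h.trans h'⟩
  inf_mem := fun ⟨x, hx, h⟩ ⟨y, hy, h'⟩ => ⟨x ⊓ y, hF.inf_mem hx hy,
    le_inf ((inf_le_inf_right c inf_le_left).trans h) ((inf_le_inf_right c inf_le_right).trans h')⟩

theorem subset_filterAdjoin (F : Set L) (c : L) : F ⊆ filterAdjoin F c :=
  fun x hx => ⟨x, hx, inf_le_left⟩

theorem mem_filterAdjoin {F : Set L} (hF : F.Nonempty) (c : L) : c ∈ filterAdjoin F c :=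
  let ⟨x, hx⟩ := hF; ⟨x, hx, inf_le_right⟩

/-- The two-element irreducibility condition extends to finite families. -/
theorem IsIrreducibleFilter.exists_inf_le_of_finset {p : Set L} (hp : IsIrreducibleFilter p)
    {ι : Type*} {s : Finset ι} (hs : s.Nonempty) (c : ι → L) (hc : ∀ i ∈ s, c i ∉ p) :
    ∃ x ∈ p, ∃ z ∉ p, ∀ i ∈ s, x ⊓ c i ≤ z := by
  induction hs using Finset.Nonempty.cons_induction with
  | singleton i =>
    obtain ⟨x, hx, z, hz, h, -⟩ := hp.exists_inf_le (hc i (by simp)) (hc i (by simp))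
    exact ⟨x, hx, z, hz, by simpa using h⟩
  | cons i s hi hs ih =>
    obtain ⟨x, hx, z, hz, h⟩ := ih fun j hj => hc j (by simp [hj])
    obtain ⟨x', hx', z', hz', h₁, h₂⟩ := hp.exists_inf_le hz (hc i (by simp))
    refine ⟨x ⊓ x', hp.inf_mem hx hx', z', hz', fun j hj => ?_⟩
    rw [Finset.mem_cons] at hj
    obtain rfl | hj := hj
    · exact (inf_le_inf_right _ inf_le_right).trans h₂
    · refine le_trans (le_inf (inf_le_left.trans inf_le_right) ?_) h₁
      exact (inf_le_inf_right _ inf_le_left).trans (h j hj)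

/-- Filters maximal without a given element are irreducible, so that irreducible filters separate
elements. -/
theorem exists_isIrreducibleFilter {a b : L} (h : ¬ a ≤ b) :
    ∃ p, IsIrreducibleFilter p ∧ a ∈ p ∧ b ∉ p := by
  obtain ⟨p, hap, hp⟩ := zorn_subset_nonempty {F : Set L | IsLatticeFilter F ∧ b ∉ F} (by
    intro C hC hchain hne
    refine ⟨⋃₀ C, ⟨⟨?_, ?_⟩, ?_⟩, fun s hs => Set.subset_sUnion_of_mem hs⟩
    · rintro x y ⟨F, hF, hx⟩ hxy
      exact ⟨F, hF, (hC hF).1.upper hx hxy⟩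
    · rintro x y ⟨F, hF, hx⟩ ⟨G, hG, hy⟩
      obtain hFG | hGF := hchain.total hF hG
      · exact ⟨G, hG, (hC hG).1.inf_mem (hFG hx) hy⟩
      · exact ⟨F, hF, (hC hF).1.inf_mem hx (hGF hy)⟩
    · rintro ⟨F, hF, hb⟩
      exact (hC hF).2 hb) (Set.Ici a) ⟨isLatticeFilter_Ici a, h⟩
  obtain ⟨⟨hpf, hbp⟩, hmax⟩ := hp
  have ha : a ∈ p := hap le_rfl
  refine ⟨p, ⟨hpf, fun h => hbp (h ▸ Set.mem_univ b), fun {c d} hc hd => ?_⟩, ha, hbp⟩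
  have key : ∀ c ∉ p, ∃ x ∈ p, x ⊓ c ≤ b := fun c hc => by
    by_contra hcon
    exact hc (hmax ⟨isLatticeFilter_filterAdjoin hpf c, hcon⟩ (subset_filterAdjoin p c)
      (mem_filterAdjoin ⟨a, ha⟩ c))
  obtain ⟨x, hx, hxc⟩ := key c hc
  obtain ⟨y, hy, hyd⟩ := key d hd
  exact ⟨x ⊓ y, hpf.inf_mem hx hy, b, hbp, (inf_le_inf_right c inf_le_left).trans hxc,
    (inf_le_inf_right d inf_le_right).trans hyd⟩

variable {n : ℕ} {hn : 0 < n}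

/-- In an `n`-distributive lattice, an irreducible filter has no irredundant cover of size
`n + 1`. -/
theorem IsNDistributive.not_filterCover (hL : IsNDistributive n hn L) {p : Set L}
    (hp : IsIrreducibleFilter p) {q : Fin (n + 1) → Set L} (hq : ∀ i, IsLatticeFilter (q i))
    (hirr : FilterIrredundant q p) : ¬ FilterCover q p := by
  intro hcov
  choose c hcp hcq using hirr
  let y : Fin (n + 1) → L := fun j => (Finset.univ.erase j).inf' (erase_univ_nonempty hn j) c
  have hy : ∀ j, y j ∈ q j := fun j =>
    Finset.inf'_mem (q j) (fun _ h _ h' => (hq j).inf_mem h h') _ _ _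
      fun i hi => hcq i j (Finset.ne_of_mem_erase hi).symm
  have hsup : Finset.univ.sup' Finset.univ_nonempty y ∈ p := hcov _ fun j =>
    (hq j).upper (hy j) (Finset.le_sup' y (Finset.mem_univ j))
  obtain ⟨x, hx, z, hz, hxz⟩ := hp.exists_inf_le_of_finset Finset.univ_nonempty c
    fun i _ => hcp i
  refine hz (hp.upper (hp.inf_mem hx hsup) ?_)
  rw [hL]
  refine Finset.sup'_le _ _ fun i hi => le_trans (inf_le_inf_left x ?_) (hxz i hi)
  exact Finset.sup'_le _ _ fun j hj =>
    Finset.inf'_le c (Finset.mem_erase.2 ⟨(Finset.ne_of_mem_erase hj).symm, hi⟩)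

/-- In an `n`-distributive lattice, every finite cover of an irreducible filter contains a cover
of size at most `n`. -/
theorem IsNDistributive.exists_subcover (hL : IsNDistributive n hn L) {p : Set L}
    (hp : IsIrreducibleFilter p) {ι : Type*} {q : ι → Set L} (hq : ∀ i, IsLatticeFilter (q i))
    (T : Finset ι) (hT : ∀ x, (∀ i ∈ T, x ∈ q i) → x ∈ p) :
    ∃ S ⊆ T, S.card ≤ n ∧ ∀ x, (∀ i ∈ S, x ∈ q i) → x ∈ p := by
  classical
  induction T using Finset.strongInduction with
  | H T ih =>
    by_cases hcard : T.card ≤ n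
    · exact ⟨T, Finset.Subset.refl T, hcard, hT⟩
    -- Sort the members of `T` into `n + 1` nonempty groups and apply the bound to the groups.
    obtain ⟨g⟩ : Nonempty (Fin (n + 1) ↪ T) := Function.Embedding.nonempty_of_card_le (by
      simp only [Fintype.card_fin, Fintype.card_coe]; omega)
    let f : T → Fin (n + 1) := Function.invFun g
    have hf : ∀ i, f (g i) = i := Function.leftInverse_invFun g.injective
    let Q : Fin (n + 1) → Set L := fun i => {x | ∀ t : T, f t = i → x ∈ q t}
    have hQ : ∀ i, IsLatticeFilter (Q i) := fun i =>
      ⟨fun hx hxy t ht => (hq t).upper (hx t ht) hxy,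
        fun hx hy t ht => (hq t).inf_mem (hx t ht) (hy t ht)⟩
    have hcov : FilterCover Q p := fun x hx => hT x fun i hi => hx (f ⟨i, hi⟩) ⟨i, hi⟩ rfl
    have hred : ¬ FilterIrredundant Q p := fun h => hL.not_filterCover hp hQ h hcov
    simp only [FilterIrredundant, not_forall, not_exists, not_and] at hred
    obtain ⟨i, hi⟩ := hred
    obtain ⟨S, hS, hSn, hSp⟩ := ih (T.erase (g i)) (Finset.erase_ssubset (g i).2) (by
      intro x hx
      by_contra hxp
      obtain ⟨j, hj⟩ : ∃ j, j ≠ i ∧ x ∉ Q j := by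
        simpa using hi x hxp
      refine hj.2 fun t ht => hx t (Finset.mem_erase.2 ⟨fun h => hj.1 ?_, t.2⟩)
      rw [← ht, Subtype.ext h, hf])
    exact ⟨S, hS.trans (Finset.erase_subset _ _), hSn, hSp⟩

theorem IsNDistributive.card_le_of_filterIrredundant (hL : IsNDistributive n hn L) {p : Set L}
    (hp : IsIrreducibleFilter p) {ι : Type*} [Fintype ι] {q : ι → Set L}
    (hq : ∀ i, IsLatticeFilter (q i)) (hcov : FilterCover q p) (hirr : FilterIrredundant q p) :
    Fintype.card ι ≤ n := by
  obtain ⟨S, -, hSn, hS⟩ := hL.exists_subcover hp hq Finset.univ (by simpa [FilterCover] using hcov)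
  by_contra hcard
  obtain ⟨i, hi⟩ : ∃ i, i ∉ S := by
    by_contra! h
    exact hcard (by rwa [← Finset.card_univ, ← Finset.eq_univ_of_forall h])
  obtain ⟨c, hcp, hc⟩ := hirr i
  exact hcp (hS c fun j hj => hc j (ne_of_mem_of_not_mem hj hi))

/-- Every finite cover of a filter can be refined to one all of whose members are as large as
possible: covers are stable under unions of chains because they are finite. -/
theorem exists_maximal_filterCover {ι : Type*} [Finite ι] {p : Set L} {q : ι → Set L}
    (hq : ∀ i, IsLatticeFilter (q i)) (hcov : FilterCover q p) :
    ∃ r, q ≤ r ∧ Maximal (fun r => (∀ i, IsLatticeFilter (r i)) ∧ FilterCover r p) r := by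
  refine zorn_le_nonempty₀ {r : ι → Set L | (∀ i, IsLatticeFilter (r i)) ∧ FilterCover r p} ?_ q
    ⟨hq, hcov⟩
  intro C hC hchain r₀ hr₀
  have hdir : ∀ r ∈ C, ∀ s ∈ C, ∃ t ∈ C, r ≤ t ∧ s ≤ t := fun r hr s hs =>
    (hchain.total hr hs).elim (fun h => ⟨s, hs, h, le_rfl⟩) fun h => ⟨r, hr, le_rfl, h⟩
  refine ⟨fun i => {x | ∃ r ∈ C, x ∈ r i}, ⟨fun i => ⟨?_, ?_⟩, ?_⟩, fun r hr i x hx => ⟨r, hr, hx⟩⟩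
  · rintro x y ⟨r, hr, hx⟩ hxy
    exact ⟨r, hr, ((hC hr).1 i).upper hx hxy⟩
  · rintro x y ⟨r, hr, hx⟩ ⟨s, hs, hy⟩
    obtain ⟨t, ht, hrt, hst⟩ := hdir r hr s hs
    exact ⟨t, ht, ((hC ht).1 i).inf_mem (hrt i hx) (hst i hy)⟩
  · intro x hx
    choose r hr hxr using hx
    obtain ⟨M, hM⟩ : ∃ M : C, ∀ i, (⟨r i, hr i⟩ : C) ≤ M := by
      have : Nonempty C := ⟨⟨r₀, hr₀⟩⟩
      have : IsDirectedOrder C := ⟨fun a b =>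
        let ⟨t, ht, h, h'⟩ := hdir a a.2 b b.2; ⟨⟨t, ht⟩, h, h'⟩⟩
      exact Finite.exists_le _
    exact (hC M.2).2 x fun i => hM i i (hxr i)

/-- If `a ⊔ b` lies in the irreducible filter `p`, while neither `a` nor `b` does, then `p` has a
cover by at most `n` irreducible filters that contain `a` or `b`: take an irredundant cover of the
largest size and enlarge its members as much as possible; a reducible member could be split in
two. -/
theorem IsNDistributive.exists_irreducible_cover (hL : IsNDistributive n hn L) {p : Set L}
    (hp : IsIrreducibleFilter p) {a b : L} (hab : a ⊔ b ∈ p) (ha : a ∉ p) (hb : b ∉ p) :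
    ∃ k ≤ n, ∃ q : Fin k → Set L, (∀ i, IsIrreducibleFilter (q i)) ∧
      (∀ i, a ∈ q i ∨ b ∈ q i) ∧ FilterCover q p := by
  classical
  let P : ℕ → Prop := fun k => ∃ q : Fin k → Set L, (∀ i, IsLatticeFilter (q i)) ∧
      (∀ i, a ∈ q i ∨ b ∈ q i) ∧ FilterCover q p ∧ FilterIrredundant q p
  have hPn : ∀ k, P k → k ≤ n := fun k ⟨q, hq, _, hcov, hirr⟩ => by
    simpa using hL.card_le_of_filterIrredundant hp hq hcov hirr
  have hP2 : P 2 := by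
    refine ⟨![Set.Ici a, Set.Ici b], ?_, ?_, ?_, ?_⟩
    · simp [Fin.forall_fin_two, isLatticeFilter_Ici]
    · simp [Fin.forall_fin_two]
    · intro x hx
      simp only [Fin.forall_fin_two, Matrix.cons_val_zero, Matrix.cons_val_one,
        Set.mem_Ici] at hx
      exact hp.upper hab (sup_le hx.1 hx.2)
    · simp only [FilterIrredundant, Fin.forall_fin_two]
      exact ⟨⟨b, hb, by simp⟩, ⟨a, ha, by simp⟩⟩
  have hPk : P (Nat.findGreatest P n) := Nat.findGreatest_spec (hPn 2 hP2) hP2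
  have hmaxk : ¬ P (Nat.findGreatest P n + 1) := fun h =>
    absurd (Nat.le_findGreatest (hPn _ h) h) (by omega)
  generalize Nat.findGreatest P n = k at hPk hmaxk
  have hkn := hPn k hPk
  obtain ⟨q₀, hq₀, hab₀, hcov₀, hirr₀⟩ := hPk
  obtain ⟨q, hle, ⟨hq, hcov⟩, hmax⟩ := exists_maximal_filterCover hq₀ hcov₀
  have habq : ∀ i, a ∈ q i ∨ b ∈ q i := fun i => (hab₀ i).imp (hle i ·) (hle i ·)
  have hirr : FilterIrredundant q p := fun i =>
    let ⟨c, hc, h⟩ := hirr₀ i; ⟨c, hc, fun j hj => hle j (h j hj)⟩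
  refine ⟨k, hkn, q, fun i => ⟨hq i, fun hi => ?_, fun {c d} hc hd => ?_⟩, habq, hcov⟩
  · obtain ⟨c, hcp, h⟩ := hirr i
    refine hcp (hcov c fun j => ?_)
    by_cases hj : j = i
    · rw [hj, hi]; trivial
    · exact h j hj
  · by_contra! hcon
    have hne : (q i).Nonempty := (habq i).elim (⟨a, ·⟩) (⟨b, ·⟩)
    -- By maximality, replacing `q i` by a larger filter destroys the cover.
    have hbreak : ∀ e, e ∉ q i → ∃ x ∉ p, x ∈ filterAdjoin (q i) e ∧ ∀ j, j ≠ i → x ∈ q j := by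
      intro e he
      by_contra! hno
      have hup : q ≤ Function.update q i (filterAdjoin (q i) e) := by
        rw [le_update_iff]
        exact ⟨subset_filterAdjoin _ _, fun _ _ => le_rfl⟩
      have := hmax ⟨fun j => ?_, fun x hx => ?_⟩ hup i
      · rw [Function.update_self] at this
        exact he (this (mem_filterAdjoin hne e))
      · by_cases hj : j = i
        · subst hj
          rw [Function.update_self]
          exact isLatticeFilter_filterAdjoin (hq j) e
        · rw [Function.update_of_ne hj]
          exact hq j
      · by_contra hxp
        obtain ⟨j, hj, hxj⟩ := hno x hxp (by simpa using hx i)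
        exact hxj (by simpa [Function.update_of_ne hj] using hx j)
    refine hmaxk ⟨Fin.cons (filterAdjoin (q i) d) (Function.update q i (filterAdjoin (q i) c)),
      ?_, ?_, ?_, ?_⟩
    · rw [Fin.forall_fin_succ]
      refine ⟨isLatticeFilter_filterAdjoin (hq i) d, fun j => ?_⟩
      rw [Fin.cons_succ]
      by_cases hj : j = i
      · subst hj
        rw [Function.update_self]
        exact isLatticeFilter_filterAdjoin (hq j) c
      · rw [Function.update_of_ne hj]
        exact hq j
    · rw [Fin.forall_fin_succ]
      refine ⟨(habq i).imp (subset_filterAdjoin _ _ ·) (subset_filterAdjoin _ _ ·), fun j => ?_⟩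
      rw [Fin.cons_succ]
      by_cases hj : j = i
      · subst hj
        rw [Function.update_self]
        exact (habq j).imp (subset_filterAdjoin _ _ ·) (subset_filterAdjoin _ _ ·)
      · rw [Function.update_of_ne hj]
        exact habq j
    · intro x hx
      rw [Fin.forall_fin_succ] at hx
      simp only [Fin.cons_zero, Fin.cons_succ] at hx
      obtain ⟨⟨y, hy, hyx⟩, hx⟩ := hx
      refine hcov x fun j => ?_
      by_cases hj : j = i
      · subst hj
        obtain ⟨y', hy', hyx'⟩ := by simpa using hx j
        by_contra hxj
        exact hcon (y ⊓ y') ((hq j).inf_mem hy hy') x hxj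
          ((inf_le_inf_right c inf_le_right).trans hyx')
          ((inf_le_inf_right d inf_le_left).trans hyx)
      · simpa [Function.update_of_ne hj] using hx j
    · intro j'
      simp only [Fin.forall_fin_succ, Fin.cons_zero, Fin.cons_succ]
      refine Fin.cases ?_ (fun j => ?_) j'
      · obtain ⟨x, hxp, hxi, hx⟩ := hbreak c hc
        refine ⟨x, hxp, fun h => absurd rfl h, fun l _ => ?_⟩
        by_cases hl : l = i
        · subst hl; simpa using hxi
        · simpa [Function.update_of_ne hl] using hx l hl
      · by_cases hj : j = i
        · subst hj
          obtain ⟨x, hxp, hxi, hx⟩ := hbreak d hd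
          refine ⟨x, hxp, fun _ => hxi, fun l hl => ?_⟩
          have hl : l ≠ j := fun h => hl (h ▸ rfl)
          simpa [Function.update_of_ne hl] using hx l hl
        · obtain ⟨x, hxp, hx⟩ := hirr j
          refine ⟨x, hxp, fun _ => subset_filterAdjoin _ _ (hx i (Ne.symm hj)), fun l hl => ?_⟩
          have hl : l ≠ j := fun h => hl (h ▸ rfl)
          by_cases hli : l = i
          · subst hli
            simpa using subset_filterAdjoin _ _ (hx l hl)
          · simpa [Function.update_of_ne hli] using hx l hl

end Filters

/-! ### The lattice of closed sets of a closure operator -/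

section ClosedSets

variable {P : Type u}

instance (c : ClosureOperator (Set P)) : Lattice c.Closeds := c.gi.liftLattice

/-- If the closure of every set is the union of the closures of its subsets with at most `n`
elements, then the lattice of closed sets is `n`-distributive: `n` points from the union of `n + 1`
sets avoid one of these sets. -/
theorem ClosureOperator.isNDistributive_closeds {n : ℕ} (hn : 0 < n) (c : ClosureOperator (Set P))
    (hc : ∀ A, ∀ x ∈ c A, ∃ B : Finset P, ↑B ⊆ A ∧ B.card ≤ n ∧ x ∈ c ↑B) :
    IsNDistributive n hn c.Closeds := by
  intro X Y
  refine le_antisymm ?_ (Finset.sup'_le _ _ fun i _ =>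
    inf_le_inf_left X (Finset.sup'_mono Y (Finset.erase_subset _ _) _))
  rintro p ⟨hpX, hpY⟩
  have hle : Finset.univ.sup' Finset.univ_nonempty Y ≤ c.toCloseds (⋃ i, (Y i : Set P)) :=
    Finset.sup'_le _ _ fun i _ => (Set.subset_iUnion (fun i => (Y i : Set P)) i).trans
      (c.le_closure _)
  obtain ⟨B, hBY, hBn, hpB⟩ := hc _ p (hle hpY)
  have hBY' : ∀ b : B, ∃ i, b.1 ∈ (Y i : Set P) := fun b => Set.mem_iUnion.1 (hBY b.2)
  choose f hf using hBY'
  obtain ⟨i, hi⟩ : ∃ i, ∀ b, f b ≠ i := by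
    by_contra! h
    have := Fintype.card_le_of_surjective f h
    simp only [Fintype.card_fin, Fintype.card_coe] at this
    omega
  refine Finset.le_sup' (fun i => X ⊓ (Finset.univ.erase i).sup' (erase_univ_nonempty hn i) Y)
    (Finset.mem_univ i) ⟨hpX, ?_⟩
  refine c.closure_min (fun b hb => ?_)
    ((Finset.univ.erase i).sup' (erase_univ_nonempty hn i) Y).2 hpB
  exact Finset.le_sup' Y (Finset.mem_erase.2 ⟨hi ⟨b, hb⟩, Finset.mem_univ _⟩) (hf ⟨b, hb⟩)

end ClosedSets

/-! ### Finite refutations -/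

section FiniteRefutation

variable {L : Type u}

/-- The closure operator on a set `Q` of filters that adds to `A` all filters covered by `A`. -/
def filterClosure (Q : Set (Set L)) : ClosureOperator (Set Q) :=
  ClosureOperator.mk₂ (fun A => {p | ∀ x, (∀ q ∈ A, x ∈ (q : Set L)) → x ∈ (p : Set L)})
    (fun _ _ hp _ hx => hx _ hp)
    (fun _ _ hAB _ hp x hx => hp x fun _ hq => hAB hq x hx)

theorem mem_filterClosure {Q : Set (Set L)} {A : Set Q} {p : Q} :
    p ∈ filterClosure Q A ↔ ∀ x, (∀ q ∈ A, x ∈ (q : Set L)) → x ∈ (p : Set L) := Iff.rfl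

/-- The closed set of all filters in `Q` that contain `a`. -/
def filtersContaining (Q : Set (Set L)) (a : L) : (filterClosure Q).Closeds :=
  ⟨{q | a ∈ (q : Set L)}, (filterClosure Q).isClosed_iff_closure_le.2 fun _ hp =>
    hp a fun _ hq => hq⟩

variable [Lattice L]

theorem IsNDistributive.isNDistributive_filterClosure {n : ℕ} {hn : 0 < n}
    (hL : IsNDistributive n hn L) {Q : Set (Set L)} (hfin : Q.Finite)
    (hQ : ∀ q ∈ Q, IsIrreducibleFilter q) :
    IsNDistributive n hn (filterClosure Q).Closeds := by
  have := hfin.to_subtype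
  refine (filterClosure Q).isNDistributive_closeds hn fun A p hp => ?_
  obtain ⟨S, hSA, hSn, hS⟩ := hL.exists_subcover (hQ p p.2) (q := fun q : Q => q.1)
    (fun q => (hQ q q.2).toIsLatticeFilter) A.toFinite.toFinset (by
      simpa using! mem_filterClosure.1 hp)
  exact ⟨S, by simpa using! hSA, hSn, mem_filterClosure.2 (by simpa using! hS)⟩

variable {X : Type w}

/-- The value of a term in the lattice of closed subsets of `Q`, where the variable `x` stands for
the set of all filters in `Q` that contain `a x`. -/
def evalFilters (Q : Set (Set L)) (a : X → L) (t : LatticeTerm X) : (filterClosure Q).Closeds :=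
  t.eval fun x => filtersContaining Q (a x)

/-- Evaluating a term in the closed sets never gives more than evaluating it in `L`. -/
theorem evalFilters_le_filtersContaining {Q : Set (Set L)}
    (hQ : ∀ q ∈ Q, IsLatticeFilter q) (a : X → L) (t : LatticeTerm X) :
    evalFilters Q a t ≤ filtersContaining Q (t.eval a) := by
  induction t with
  | var x => exact le_rfl
  | sup s t hs ht =>
    refine sup_le (hs.trans fun q hq => ?_) (ht.trans fun q hq => ?_)
    · exact (hQ q q.2).upper hq le_sup_left
    · exact (hQ q q.2).upper hq le_sup_right
  | inf s t hs ht =>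
    rintro q ⟨hqs, hqt⟩
    exact (hQ q q.2).inf_mem (hs hqs) (ht hqt)

/-- A bound on the number of irreducible filters needed to witness that the value of a term lies
in a given one: see `exists_finset_mem_eval`. -/
def witnessBound (n : ℕ) : LatticeTerm X → ℕ
  | .var _ => 1
  | .sup s t => 1 + n * (witnessBound n s + witnessBound n t)
  | .inf s t => witnessBound n s + witnessBound n t

/-- If the value of a term lies in an irreducible filter `p`, then finitely many irreducible
filters, in a number that depends on `n` and the term only, witness this: `p` belongs to the value
of the term in every closed-set lattice built on a set containing them. -/
theorem IsNDistributive.exists_finset_mem_eval {n : ℕ} {hn : 0 < n}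
    (hL : IsNDistributive n hn L) (a : X → L) (t : LatticeTerm X) {p : Set L}
    (hp : IsIrreducibleFilter p) (hpt : t.eval a ∈ p) :
    ∃ F : Finset (Set L), F.card ≤ witnessBound n t ∧ (∀ q ∈ F, IsIrreducibleFilter q) ∧ p ∈ F ∧
      ∀ Q : Set (Set L), ↑F ⊆ Q → ∀ hpQ : p ∈ Q,
        ⟨p, hpQ⟩ ∈ (evalFilters Q a t : Set Q) := by
  classical
  induction t generalizing p with
  | var x =>
    exact ⟨{p}, by simp [witnessBound], by simpa using hp, by simp, fun Q _ hpQ => hpt⟩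
  | inf s t hs ht =>
    obtain ⟨F, hFc, hF, hpF, hFs⟩ := hs hp (hp.upper hpt inf_le_left)
    obtain ⟨G, hGc, hG, hpG, hGt⟩ := ht hp (hp.upper hpt inf_le_right)
    refine ⟨F ∪ G, (Finset.card_union_le F G).trans (add_le_add hFc hGc), fun q hq => ?_,
      Finset.mem_union_left _ hpF, fun Q hQ hpQ => ⟨?_, ?_⟩⟩
    · exact (Finset.mem_union.1 hq).elim (hF q) (hG q)
    · exact hFs Q (fun q hq => hQ (Finset.mem_union_left _ hq)) hpQ
    · exact hGt Q (fun q hq => hQ (Finset.mem_union_right _ hq)) hpQ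
  | sup s t hs ht =>
    have hle : ∀ k, k ≤ witnessBound n s + witnessBound n t →
        k ≤ witnessBound n (s.sup t) := fun k hk => by
      have := Nat.mul_le_mul_right (witnessBound n s + witnessBound n t) hn
      simp only [witnessBound]
      omega
    by_cases hps : s.eval a ∈ p
    · obtain ⟨F, hFc, hF, hpF, hFs⟩ := hs hp hps
      exact ⟨F, hle _ (by omega), hF, hpF, fun Q hQ hpQ =>
        (le_sup_left : _ ≤ evalFilters Q a s ⊔ _) (hFs Q hQ hpQ)⟩
    by_cases hpt' : t.eval a ∈ p
    · obtain ⟨F, hFc, hF, hpF, hFt⟩ := ht hp hpt'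
      exact ⟨F, hle _ (by omega), hF, hpF, fun Q hQ hpQ =>
        (le_sup_right : _ ≤ _ ⊔ evalFilters Q a t) (hFt Q hQ hpQ)⟩
    -- The bound for each of the at most `n` members of the cover, and `1` for `p` itself.
    obtain ⟨k, hkn, q, hq, hqst, hcov⟩ := hL.exists_irreducible_cover hp hpt hps hpt'
    have hex : ∀ i, ∃ F : Finset (Set L), F.card ≤ witnessBound n s + witnessBound n t ∧
        (∀ q ∈ F, IsIrreducibleFilter q) ∧ q i ∈ F ∧
        ∀ Q : Set (Set L), ↑F ⊆ Q → ∀ hqQ : q i ∈ Q,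
          ⟨q i, hqQ⟩ ∈ (evalFilters Q a (s.sup t) : Set Q) := by
      intro i
      obtain h | h := hqst i
      · obtain ⟨F, hFc, hF, hpF, hFs⟩ := hs (hq i) h
        exact ⟨F, by omega, hF, hpF, fun Q hQ hqQ =>
          (le_sup_left : _ ≤ evalFilters Q a s ⊔ _) (hFs Q hQ hqQ)⟩
      · obtain ⟨F, hFc, hF, hpF, hFt⟩ := ht (hq i) h
        exact ⟨F, by omega, hF, hpF, fun Q hQ hqQ =>
          (le_sup_right : _ ≤ _ ⊔ evalFilters Q a t) (hFt Q hQ hqQ)⟩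
    choose F hFc hF hqF hFst using hex
    refine ⟨insert p (Finset.univ.biUnion F), ?_, ?_, Finset.mem_insert_self _ _, ?_⟩
    · have h₁ : (Finset.univ.biUnion F).card ≤
          k * (witnessBound n s + witnessBound n t) := by
        simpa using Finset.card_biUnion_le_card_mul Finset.univ F _ fun i _ => hFc i
      have h₂ := Nat.mul_le_mul_right (witnessBound n s + witnessBound n t) hkn
      have h₃ := Finset.card_insert_le p (Finset.univ.biUnion F)
      simp only [witnessBound]
      omega
    · intro r hr
      obtain rfl | hr := Finset.mem_insert.1 hr
      · exact hp
      · obtain ⟨i, -, hi⟩ := Finset.mem_biUnion.1 hr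
        exact hF i r hi
    · intro Q hQ hpQ
      have hsub : ∀ i, ↑(F i) ⊆ Q := fun i r hr =>
        hQ (Finset.mem_insert_of_mem (Finset.mem_biUnion.2 ⟨i, Finset.mem_univ i, hr⟩))
      refine (filterClosure Q).isClosed_iff_closure_le.1
        (evalFilters Q a (s.sup t)).2 ?_
      exact fun x hx => hcov x fun i => hx ⟨_, hsub i (hqF i)⟩ (hFst i Q (hsub i) _)

/-- An inequality that fails in some `n`-distributive lattice fails in a finite one, of bounded
size. -/
theorem IsNDistributive.exists_finite_refutation {n : ℕ} {hn : 0 < n}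
    (hL : IsNDistributive n hn L) (a : X → L) {s t : LatticeTerm X}
    (hst : ¬ s.eval a ≤ t.eval a) :
    ∃ (C : Type u) (_ : Lattice C), Finite C ∧ Nat.card C ≤ 2 ^ witnessBound n s ∧
      IsNDistributive n hn C ∧ ∃ b : X → C, ¬ s.eval b ≤ t.eval b := by
  obtain ⟨p, hp, hps, hpt⟩ := exists_isIrreducibleFilter hst
  obtain ⟨F, hFc, hF, hpF, hFs⟩ := hL.exists_finset_mem_eval a s hp hps
  refine ⟨(filterClosure (F : Set (Set L))).Closeds, inferInstance, inferInstance, ?_,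
    hL.isNDistributive_filterClosure F.finite_toSet hF,
    fun x => filtersContaining F (a x), fun hle => hpt ?_⟩
  · calc Nat.card (filterClosure (F : Set (Set L))).Closeds
        ≤ Nat.card (Set (F : Set (Set L))) := Nat.card_le_card_of_injective _ Subtype.val_injective
      _ = 2 ^ F.card := by simp [Nat.card_eq_fintype_card]
      _ ≤ 2 ^ witnessBound n s := Nat.pow_le_pow_right two_pos hFc
  · have hle' : evalFilters (F : Set (Set L)) a s ≤ evalFilters F a t := hle
    exact evalFilters_le_filtersContaining (fun q hq => (hF q hq).toIsLatticeFilter) a t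
      (hle' (hFs F subset_rfl hpF))

end FiniteRefutation

/-! ### The variety of `n`-distributive lattices -/

theorem exists_term_eval_eq_sup' {X : Type w} {ι : Type*} {s : Finset ι} (hs : s.Nonempty)
    (f : ι → LatticeTerm X) :
    ∃ t : LatticeTerm X, ∀ (L : Type u) [Lattice L] (a : X → L),
      t.eval a = s.sup' hs fun i => (f i).eval a := by
  induction hs using Finset.Nonempty.cons_induction with
  | singleton i => exact ⟨f i, fun L _ a => by simp⟩
  | cons i s hi hs ih =>
    obtain ⟨t, ht⟩ := ih
    exact ⟨(f i).sup t, fun L _ a => by rw [Finset.sup'_cons hs, LatticeTerm.eval, ht]⟩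

/-- `n`-distributivity is expressed by a single identity. -/
theorem exists_identity_isNDistributive (n : ℕ) (hn : 0 < n) :
    ∃ e : LatticeTerm ℕ × LatticeTerm ℕ, ∀ (L : Type u) [Lattice L],
      IsNDistributive n hn L ↔ SatisfiesIdentity L e.1 e.2 := by
  -- The variable `0` stands for `x`, and the variable `i + 1` for `y i`.
  let y : Fin (n + 1) → LatticeTerm ℕ := fun i => .var (i + 1)
  obtain ⟨l, hl⟩ := exists_term_eval_eq_sup'.{u} Finset.univ_nonempty y
  have hr := fun i => exists_term_eval_eq_sup'.{u} (erase_univ_nonempty hn i) y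
  choose r hr using hr
  obtain ⟨r', hr'⟩ := exists_term_eval_eq_sup'.{u} Finset.univ_nonempty
    fun i => (LatticeTerm.var 0).inf (r i)
  refine ⟨((LatticeTerm.var 0).inf l, r'), fun L _ => ⟨fun h a => ?_, fun h x z => ?_⟩⟩
  · simpa only [LatticeTerm.eval, hl, hr, hr', y] using h (a 0) fun i => a (i + 1)
  · have := h fun k => if k = 0 then x else z (Fin.ofNat (n + 1) (k - 1))
    simpa [LatticeTerm.eval, hl, hr, hr', y] using this

theorem isVarietyGeneratedBy_finite (n : ℕ) (hn : 0 < n) :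
    IsVarietyGeneratedBy.{u} (fun L [Lattice L] => IsNDistributive n hn L)
      (fun L [Lattice L] => Finite L ∧ IsNDistributive n hn L) := by
  refine ⟨?_, fun L _ h => h.2, ?_⟩
  · obtain ⟨e, he⟩ := exists_identity_isNDistributive n hn
    exact ⟨{e}, fun L _ => by simpa using he L⟩
  · rintro W ⟨E, hE⟩ hfin L _ hL
    refine (hE L).2 fun e he a => ?_
    have key : ∀ s t : LatticeTerm ℕ, (∀ (C : Type u) [Lattice C], Finite C →
        IsNDistributive n hn C → SatisfiesIdentity C s t) → s.eval a ≤ t.eval a := by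
      intro s t hst
      by_contra hlt
      obtain ⟨C, _, hCfin, -, hC, b, hb⟩ := hL.exists_finite_refutation a hlt
      exact hb (hst C hCfin hC b).le
    have hE' : ∀ (C : Type u) [Lattice C], Finite C → IsNDistributive n hn C →
        SatisfiesIdentity C e.1 e.2 := fun C _ hCfin hC => (hE C).1 (hfin C ⟨hCfin, hC⟩) e he
    exact le_antisymm (key _ _ hE') (key _ _ fun C _ h h' b => (hE' C h h' b).symm)

/-! ### Evaluating terms is primitive recursive -/

namespace LatticeTerm

variable {X : Type w}

/-- The value of a term in a set with two binary operations, which need not be those of a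
lattice. -/
def fold {σ : Type*} (j m : σ → σ → σ) (a : X → σ) : LatticeTerm X → σ
  | .var x => a x
  | .sup s t => j (s.fold j m a) (t.fold j m a)
  | .inf s t => m (s.fold j m a) (t.fold j m a)

theorem fold_sup_inf {L : Type*} [Lattice L] (a : X → L) (t : LatticeTerm X) :
    t.fold (· ⊔ ·) (· ⊓ ·) a = t.eval a := by
  induction t <;> simp_all [fold, eval]

theorem map_fold {σ τ : Type*} {j m : σ → σ → σ} {j' m' : τ → τ → τ} (φ : σ → τ)
    (hj : ∀ x y, φ (j x y) = j' (φ x) (φ y)) (hm : ∀ x y, φ (m x y) = m' (φ x) (φ y))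
    (a : X → σ) (t : LatticeTerm X) :
    φ (t.fold j m a) = t.fold j' m' fun x => φ (a x) := by
  induction t <;> simp_all [fold]

theorem eval_eq_fold {L : Type*} [Lattice L] {j m : L → L → L} (hj : ∀ x y, x ⊔ y = j x y)
    (hm : ∀ x y, x ⊓ y = m x y) (a : X → L) (t : LatticeTerm X) : t.eval a = t.fold j m a := by
  rw [← fold_sup_inf]
  exact map_fold id hj hm a t

/-- The variables of a term have codes bounded by the code of the term. -/
theorem fold_congr [Encodable X] {σ : Type*} {j m : σ → σ → σ} {a b : X → σ} (t : LatticeTerm X)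
    (h : ∀ x, Encodable.encode x ≤ t.toCode → a x = b x) : t.fold j m a = t.fold j m b := by
  induction t with
  | var x => exact h x (by simp only [toCode]; omega)
  | sup s t hs ht =>
    have h₁ := Nat.left_le_pair s.toCode t.toCode
    have h₂ := Nat.right_le_pair s.toCode t.toCode
    simp only [fold]
    rw [hs fun x hx => h x (by simp only [toCode]; omega),
      ht fun x hx => h x (by simp only [toCode]; omega)]
  | inf s t hs ht =>
    have h₁ := Nat.left_le_pair s.toCode t.toCode
    have h₂ := Nat.right_le_pair s.toCode t.toCode
    simp only [fold]
    rw [hs fun x hx => h x (by simp only [toCode]; omega),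
      ht fun x hx => h x (by simp only [toCode]; omega)]

/-- Structural recursion on terms is primitive recursive, by course-of-values recursion on
codes. -/
theorem primrec_fold [Primcodable X] {α σ : Type*} [Primcodable α] [Primcodable σ]
    {j m : α → σ → σ → σ} {v : α → X → σ} (hj : Primrec fun p : α × σ × σ => j p.1 p.2.1 p.2.2)
    (hm : Primrec fun p : α × σ × σ => m p.1 p.2.1 p.2.2) (hv : Primrec₂ v) :
    Primrec₂ fun (a : α) (t : LatticeTerm X) => t.fold (j a) (m a) (v a) := by
  let g : α → List (Option σ) → Option (Option σ) := fun a l =>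
    some (if l.length % 3 = 0 then
      (Encodable.decode (α := X) (l.length / 3)).map fun x => v a x
    else
      (l[(l.length / 3).unpair.1]?.getD none).bind fun s =>
        (l[(l.length / 3).unpair.2]?.getD none).map fun t =>
          if l.length % 3 = 1 then j a s t else m a s t)
  have hlen : Primrec fun p : α × List (Option σ) => p.2.length :=
    Primrec.list_length.comp Primrec.snd
  have hmod : Primrec fun p : α × List (Option σ) => p.2.length % 3 :=
    Primrec.nat_mod.comp hlen (Primrec.const 3)
  have hdiv : Primrec fun p : α × List (Option σ) => p.2.length / 3 :=
    Primrec.nat_div.comp hlen (Primrec.const 3)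
  have hp := Primrec.unpair.comp hdiv
  have hget : ∀ {i : α × List (Option σ) → ℕ}, Primrec i →
      Primrec fun p : α × List (Option σ) => p.2[i p]?.getD none := fun hi =>
    Primrec.option_getD.comp (Primrec.list_getElem?.comp Primrec.snd hi) (Primrec.const none)
  have hg : Primrec₂ g := by
    refine Primrec.option_some.comp
      (Primrec.ite (Primrec.eq.comp hmod (Primrec.const 0)) ?_ ?_)
    · exact Primrec.option_map (Primrec.decode.comp hdiv)
        (hv.comp (Primrec.fst.comp Primrec.fst) Primrec.snd).to₂
    · refine Primrec.option_bind (hget (Primrec.fst.comp hp)) ?_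
      refine Primrec.option_map ((hget (Primrec.snd.comp hp)).comp Primrec.fst) ?_
      have harg : Primrec fun q : ((α × List (Option σ)) × σ) × σ => (q.1.1.1, q.1.2, q.2) :=
        (Primrec.fst.comp (Primrec.fst.comp Primrec.fst)).pair
          ((Primrec.snd.comp Primrec.fst).pair Primrec.snd)
      exact Primrec.ite
        (Primrec.eq.comp (hmod.comp (Primrec.fst.comp Primrec.fst)) (Primrec.const 1))
        (hj.comp harg) (hm.comp harg)
  have main := Primrec.nat_strong_rec
    (fun (a : α) (k : ℕ) => (ofCode k : Option (LatticeTerm X)).map (fold (j a) (m a) (v a)))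
    (g := g) hg (by
      intro a k
      simp only [g, List.length_map, List.length_range, Option.some.injEq]
      rw [ofCode]
      by_cases h : k % 3 = 0
      · simp [h, Function.comp_def, fold]
      · have h₁ : (k / 3).unpair.1 < k :=
          lt_of_le_of_lt (Nat.unpair_left_le _) (by omega)
        have h₂ : (k / 3).unpair.2 < k :=
          lt_of_le_of_lt (Nat.unpair_right_le _) (by omega)
        simp only [h, if_false, dif_neg, not_false_eq_true, List.getElem?_map,
          List.getElem?_range h₁, List.getElem?_range h₂, Option.map_some, Option.getD_some]
        cases (ofCode (k / 3).unpair.1 : Option (LatticeTerm X)) <;>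
          cases (ofCode (k / 3).unpair.2 : Option (LatticeTerm X)) <;>
          simp
        split_ifs <;> simp [fold])
  refine Primrec.option_some_iff.1 ((main.comp Primrec.fst
    (Primrec.encode.comp Primrec.snd)).of_eq fun p => ?_)
  exact congrArg (Option.map _) (ofCode_toCode p.2)

theorem primrec_toCode [Primcodable X] : Primrec (toCode : LatticeTerm X → ℕ) := Primrec.encode

end LatticeTerm

theorem Primrec.nat_pow : Primrec₂ ((· ^ ·) : ℕ → ℕ → ℕ) :=
  Primrec₂.unpaired'.1 Nat.Primrec.pow

theorem primrec_witnessBound {X : Type w} [Primcodable X] (n : ℕ) :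
    Primrec (witnessBound n : LatticeTerm X → ℕ) := by
  have hadd : Primrec fun p : Unit × ℕ × ℕ => p.2.1 + p.2.2 :=
    Primrec.nat_add.comp (Primrec.fst.comp Primrec.snd) (Primrec.snd.comp Primrec.snd)
  have := LatticeTerm.primrec_fold (X := X) (α := Unit) (j := fun _ k l => 1 + n * (k + l))
    (m := fun _ k l => k + l) (v := fun _ _ => 1)
    (Primrec.nat_add.comp (Primrec.const 1) (Primrec.nat_mul.comp (Primrec.const n) hadd)) hadd
    (Primrec.const 1)
  refine (this.comp (Primrec.const ()) Primrec.id).of_eq fun t => ?_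
  induction t <;> simp_all [LatticeTerm.fold, witnessBound]

/-! ### Finite algebras coded by numerals -/

/-- The binary operation on `{0, …, m - 1}` whose table, read row by row, has `c` as its numeral in
base `m`. -/
def tableOp (m c i j : ℕ) : ℕ := c / m ^ (j + m * i) % m

/-- The value of a term in the algebra on `{0, …, m - 1}` whose operations have the tables `c` and
`d`, where the variable `x` has as its value the digit of `b` in base `m` at the position
`encode x`. -/
def tableEval {X : Type w} [Encodable X] (m c d b : ℕ) (t : LatticeTerm X) : ℕ :=
  t.fold (tableOp m c) (tableOp m d) fun x => b / m ^ Encodable.encode x % m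

theorem primrec_digit {α : Type*} [Primcodable α] {m b k : α → ℕ} (hm : Primrec m)
    (hb : Primrec b) (hk : Primrec k) : Primrec fun a => b a / m a ^ k a % m a :=
  Primrec.nat_mod.comp (Primrec.nat_div.comp hb (Primrec.nat_pow.comp hm hk)) hm

theorem primrec_tableOp {α : Type*} [Primcodable α] {m c i j : α → ℕ} (hm : Primrec m)
    (hc : Primrec c) (hi : Primrec i) (hj : Primrec j) :
    Primrec fun a => tableOp (m a) (c a) (i a) (j a) :=
  primrec_digit hm hc (Primrec.nat_add.comp hj (Primrec.nat_mul.comp hm hi))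

theorem primrec_tableEval {X : Type w} [Primcodable X] {α : Type*} [Primcodable α]
    {m c d b : α → ℕ} {t : α → LatticeTerm X} (hm : Primrec m) (hc : Primrec c) (hd : Primrec d)
    (hb : Primrec b) (ht : Primrec t) :
    Primrec fun a => tableEval (m a) (c a) (d a) (b a) (t a) := by
  refine (LatticeTerm.primrec_fold (j := fun a => tableOp (m a) (c a))
    (m := fun a => tableOp (m a) (d a)) (v := fun a x => b a / m a ^ Encodable.encode x % m a)
    ?_ ?_ ?_).comp Primrec.id ht
  · exact primrec_tableOp (hm.comp Primrec.fst) (hc.comp Primrec.fst) (Primrec.fst.comp Primrec.snd)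
      (Primrec.snd.comp Primrec.snd)
  · exact primrec_tableOp (hm.comp Primrec.fst) (hd.comp Primrec.fst) (Primrec.fst.comp Primrec.snd)
      (Primrec.snd.comp Primrec.snd)
  · exact primrec_digit (hm.comp Primrec.fst) (hb.comp Primrec.fst) (Primrec.encode.comp Primrec.snd)

theorem exists_digits {m : ℕ} (K : ℕ) (a : ℕ → Fin m) :
    ∃ b < m ^ K, ∀ i < K, b / m ^ i % m = a i := by
  refine ⟨finFunctionFinEquiv fun i : Fin K => a i, Fin.is_lt _, fun i hi => ?_⟩
  have := congrFun (finFunctionFinEquiv.symm_apply_apply fun i : Fin K => a i) ⟨i, hi⟩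
  exact congrArg Fin.val this

theorem exists_tableOp {m : ℕ} (f : Fin m → Fin m → Fin m) :
    ∃ c < m ^ (m * m), ∀ i j : Fin m, tableOp m c i j = f i j := by
  obtain rfl | hm := Nat.eq_zero_or_pos m
  · exact ⟨0, by simp, fun i => i.elim0⟩
  have := Fin.pos_iff_nonempty.1 hm
  obtain ⟨c, hc, h⟩ := exists_digits (m * m) fun k =>
    if hk : k < m * m then
      f (finProdFinEquiv.symm ⟨k, hk⟩).1 (finProdFinEquiv.symm ⟨k, hk⟩).2
    else Classical.arbitrary _
  refine ⟨c, hc, fun i j => ?_⟩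
  have hk : (j : ℕ) + m * i < m * m := (finProdFinEquiv (i, j)).2
  have e : (⟨j + m * i, hk⟩ : Fin (m * m)) = finProdFinEquiv (i, j) := rfl
  rw [tableOp, h _ hk, dif_pos hk, e, Equiv.symm_apply_apply]

/-- The identities that define lattices. -/
def latticeIdentities : List (LatticeTerm ℕ × LatticeTerm ℕ) :=
  let x := LatticeTerm.var 0
  let y := LatticeTerm.var 1
  let z := LatticeTerm.var 2
  [(x.sup y, y.sup x), ((x.sup y).sup z, x.sup (y.sup z)),
    (x.inf y, y.inf x), ((x.inf y).inf z, x.inf (y.inf z)),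
    (x.sup (x.inf y), x), (x.inf (x.sup y), x)]

theorem satisfiesIdentity_of_mem_latticeIdentities (L : Type u) [Lattice L]
    {e : LatticeTerm ℕ × LatticeTerm ℕ} (he : e ∈ latticeIdentities) :
    SatisfiesIdentity L e.1 e.2 := by
  intro a
  simp only [latticeIdentities, List.mem_cons, List.not_mem_nil, or_false] at he
  obtain rfl | rfl | rfl | rfl | rfl | rfl := he <;> simp only [LatticeTerm.eval]
  · exact sup_comm _ _
  · exact sup_assoc _ _ _
  · exact inf_comm _ _
  · exact inf_assoc _ _ _
  · exact sup_inf_self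
  · exact inf_sup_self

theorem exists_lattice_of_latticeIdentities {T : Type u} (j m : T → T → T)
    (h : ∀ e ∈ latticeIdentities, ∀ a : ℕ → T, e.1.fold j m a = e.2.fold j m a) :
    ∃ _ : Lattice T, (∀ x y : T, x ⊔ y = j x y) ∧ ∀ x y : T, x ⊓ y = m x y := by
  let _ : Max T := ⟨j⟩
  let _ : Min T := ⟨m⟩
  let a : T → T → T → ℕ → T := fun x y z k => if k = 0 then x else if k = 1 then y else z
  simp only [latticeIdentities, List.forall_mem_cons, LatticeTerm.fold] at h
  obtain ⟨h₁, h₂, h₃, h₄, h₅, h₆, -⟩ := h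
  exact ⟨Lattice.mk' (fun x y => h₁ (a x y x)) (fun x y z => h₂ (a x y z))
    (fun x y => h₃ (a x y x)) (fun x y z => h₄ (a x y z)) (fun x y => h₅ (a x y x))
    (fun x y => h₆ (a x y x)), fun _ _ => rfl, fun _ _ => rfl⟩

/-- The algebra with the tables `c` and `d` satisfies the identities in `E`, tested on all values
of the first `K` variables. -/
def TableSatisfies (E : List (LatticeTerm ℕ × LatticeTerm ℕ)) (K m c d : ℕ) : Prop :=
  ∀ e ∈ E, ∀ b < m ^ K, tableEval m c d b e.1 = tableEval m c d b e.2

/-- No algebra of size less than `M` that satisfies the identities in `E` refutes `s = t`. The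
digits of `b` give values to all variables of `s` and `t`, whose codes are at most those of the
terms. -/
def NoTableRefutes {X : Type w} [Encodable X] (E : List (LatticeTerm ℕ × LatticeTerm ℕ))
    (K M : ℕ) (s t : LatticeTerm X) : Prop :=
  ∀ m < M, ∀ c < m ^ (m * m), ∀ d < m ^ (m * m), TableSatisfies E K m c d →
    ∀ b < m ^ (s.toCode + t.toCode + 1), tableEval m c d b s = tableEval m c d b t

theorem PrimrecRel.forall_lt_bound {α : Type*} [Primcodable α] {R : ℕ → α → Prop} {k : α → ℕ}
    (hR : PrimrecRel R) (hk : Primrec k) : PrimrecPred fun a => ∀ b < k a, R b a :=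
  (hR.forall_mem_list.comp (Primrec.list_range.comp hk) Primrec.id).of_eq (by simp)

theorem primrecPred_tableEval_eq {X : Type w} [Primcodable X] {α : Type*} [Primcodable α]
    {m c d k : α → ℕ} {s t : α → LatticeTerm X} (hm : Primrec m) (hc : Primrec c) (hd : Primrec d)
    (hk : Primrec k) (hs : Primrec s) (ht : Primrec t) :
    PrimrecPred fun a => ∀ b < m a ^ k a,
      tableEval (m a) (c a) (d a) b (s a) = tableEval (m a) (c a) (d a) b (t a) := by
  refine PrimrecRel.forall_lt_bound ?_ (Primrec.nat_pow.comp hm hk)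
  have hev : ∀ {t : α → LatticeTerm X}, Primrec t →
      Primrec fun z : ℕ × α => tableEval (m z.2) (c z.2) (d z.2) z.1 (t z.2) := fun ht =>
    primrec_tableEval (hm.comp Primrec.snd) (hc.comp Primrec.snd) (hd.comp Primrec.snd)
      Primrec.fst (ht.comp Primrec.snd)
  exact Primrec.eq.comp (hev hs) (hev ht)

theorem primrecPred_tableSatisfies (E : List (LatticeTerm ℕ × LatticeTerm ℕ)) (K : ℕ) {α : Type*}
    [Primcodable α] {m c d : α → ℕ} (hm : Primrec m) (hc : Primrec c) (hd : Primrec d) :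
    PrimrecPred fun a => TableSatisfies E K (m a) (c a) (d a) := by
  have h : PrimrecRel fun (e : LatticeTerm ℕ × LatticeTerm ℕ) (a : α) => ∀ b < m a ^ K,
      tableEval (m a) (c a) (d a) b e.1 = tableEval (m a) (c a) (d a) b e.2 :=
    primrecPred_tableEval_eq (α := (LatticeTerm ℕ × LatticeTerm ℕ) × α) (hm.comp Primrec.snd)
      (hc.comp Primrec.snd) (hd.comp Primrec.snd) (Primrec.const K)
      (Primrec.fst.comp Primrec.fst) (Primrec.snd.comp Primrec.fst)
  exact h.forall_mem_list.comp (Primrec.const E) Primrec.id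

theorem primrecPred_noTableRefutes {X : Type w} [Primcodable X]
    (E : List (LatticeTerm ℕ × LatticeTerm ℕ)) (K : ℕ) {M : LatticeTerm X × LatticeTerm X → ℕ}
    (hM : Primrec M) :
    PrimrecPred fun p : LatticeTerm X × LatticeTerm X => NoTableRefutes E K (M p) p.1 p.2 := by
  have hsq : ∀ {β : Type w} [Primcodable β] {f : β → ℕ}, Primrec f →
      Primrec fun z => f z ^ (f z * f z) :=
    fun hf => Primrec.nat_pow.comp hf (Primrec.nat_mul.comp hf hf)
  refine PrimrecRel.forall_lt_bound (α := LatticeTerm X × LatticeTerm X) ?_ hM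
  refine PrimrecRel.forall_lt_bound (α := ℕ × LatticeTerm X × LatticeTerm X) ?_
    (hsq Primrec.fst)
  refine PrimrecRel.forall_lt_bound (α := ℕ × ℕ × LatticeTerm X × LatticeTerm X) ?_
    (hsq (Primrec.fst.comp Primrec.snd))
  -- The context is now `(d, c, m, s, t)`.
  have hd : Primrec fun z : ℕ × ℕ × ℕ × LatticeTerm X × LatticeTerm X => z.1 := Primrec.fst
  have hc : Primrec fun z : ℕ × ℕ × ℕ × LatticeTerm X × LatticeTerm X => z.2.1 :=
    Primrec.fst.comp Primrec.snd
  have hm : Primrec fun z : ℕ × ℕ × ℕ × LatticeTerm X × LatticeTerm X => z.2.2.1 :=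
    Primrec.fst.comp (Primrec.snd.comp Primrec.snd)
  have hp : Primrec fun z : ℕ × ℕ × ℕ × LatticeTerm X × LatticeTerm X => z.2.2.2 :=
    Primrec.snd.comp (Primrec.snd.comp Primrec.snd)
  have hs := Primrec.fst.comp hp
  have ht := Primrec.snd.comp hp
  have hk : Primrec fun z : ℕ × ℕ × ℕ × LatticeTerm X × LatticeTerm X =>
      z.2.2.2.1.toCode + z.2.2.2.2.toCode + 1 :=
    Primrec.succ.comp (Primrec.nat_add.comp (LatticeTerm.primrec_toCode.comp hs)
      (LatticeTerm.primrec_toCode.comp ht))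
  refine ((primrecPred_tableSatisfies E K hm hc hd).not.or
    (primrecPred_tableEval_eq hm hc hd hk hs ht)).of_eq fun z => ?_
  exact imp_iff_not_or.symm

/-! ### The decision procedure -/

/-- A map that turns two operations into tabulated ones turns evaluation of terms into evaluation
by tables. -/
theorem map_fold_eq_tableEval {X : Type w} [Encodable X] {σ : Type*} {m c d b : ℕ} (φ : σ → ℕ)
    {j k : σ → σ → σ} (hj : ∀ x y, φ (j x y) = tableOp m c (φ x) (φ y))
    (hk : ∀ x y, φ (k x y) = tableOp m d (φ x) (φ y)) {a : X → σ} {t : LatticeTerm X}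
    (ha : ∀ x, Encodable.encode x ≤ t.toCode → b / m ^ Encodable.encode x % m = φ (a x)) :
    φ (t.fold j k a) = tableEval m c d b t := by
  rw [LatticeTerm.map_fold φ hj hk]
  exact LatticeTerm.fold_congr t fun x hx => (ha x hx).symm

/-- If no table refutes `s = t`, then no finite lattice of size less than `M` with the identities
in `E` does: its operations, transported along a numbering of its elements, have tables. -/
theorem eval_eq_of_noTableRefutes {X : Type w} [Encodable X]
    {E : List (LatticeTerm ℕ × LatticeTerm ℕ)} {K M : ℕ} {s t : LatticeTerm X}
    (h : NoTableRefutes E K M s t) {C : Type v} [Lattice C] [Finite C] (hcard : Nat.card C < M)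
    (hC : ∀ e ∈ E, SatisfiesIdentity C e.1 e.2) (a : X → C) : s.eval a = t.eval a := by
  have φ := Finite.equivFin C
  generalize Nat.card C = m at φ hcard
  have hm : 0 < m := Fin.pos (φ (s.eval a))
  obtain ⟨c, hcm, hc⟩ := exists_tableOp fun x y => φ (φ.symm x ⊔ φ.symm y)
  obtain ⟨d, hdm, hd⟩ := exists_tableOp fun x y => φ (φ.symm x ⊓ φ.symm y)
  have hsup : ∀ x y : C, (φ (x ⊔ y) : ℕ) = tableOp m c (φ x) (φ y) := fun x y => by
    rw [hc, φ.symm_apply_apply, φ.symm_apply_apply]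
  have hinf : ∀ x y : C, (φ (x ⊓ y) : ℕ) = tableOp m d (φ x) (φ y) := fun x y => by
    rw [hd, φ.symm_apply_apply, φ.symm_apply_apply]
  have hsat : TableSatisfies E K m c d := by
    intro e he b _
    let z : ℕ → C := fun i => φ.symm ⟨b / m ^ i % m, Nat.mod_lt _ hm⟩
    have hz : ∀ u : LatticeTerm ℕ, (φ (u.eval z) : ℕ) = tableEval m c d b u := fun u => by
      rw [← LatticeTerm.fold_sup_inf]
      exact map_fold_eq_tableEval (fun x => (φ x : ℕ)) hsup hinf fun i _ => by simp [z]
    rw [← hz, ← hz, hC e he z]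
  obtain ⟨b, hb, hdig⟩ := exists_digits (s.toCode + t.toCode + 1)
    (Function.extend Encodable.encode (fun x => φ (a x)) fun _ => ⟨0, hm⟩)
  have hz : ∀ u : LatticeTerm X, u.toCode ≤ s.toCode + t.toCode →
      (φ (u.eval a) : ℕ) = tableEval m c d b u := fun u hu => by
    rw [← LatticeTerm.fold_sup_inf]
    refine map_fold_eq_tableEval (fun x => (φ x : ℕ)) hsup hinf fun x hx => ?_
    rw [hdig _ (by omega), Encodable.encode_injective.extend_apply]
  have := h m hcard c hcm d hdm hsat b hb
  rw [← hz s (by omega), ← hz t (by omega)] at this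
  exact φ.injective (Fin.ext this)

/-- Conversely, an algebra given by tables that satisfies the lattice identities is a lattice. The
exponent `K` exceeds the codes of all terms in `E`, so that testing the first `K` variables tests
the identities in full. -/
theorem noTableRefutes_of_forall_eval_eq {X : Type w} [Encodable X]
    {E : List (LatticeTerm ℕ × LatticeTerm ℕ)} {K : ℕ}
    (hK : ∀ e ∈ E, e.1.toCode < K ∧ e.2.toCode < K) (hE : latticeIdentities ⊆ E)
    {s t : LatticeTerm X}
    (h : ∀ (L : Type v) [Lattice L], (∀ e ∈ E, SatisfiesIdentity L e.1 e.2) →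
      ∀ a : X → L, s.eval a = t.eval a) (M : ℕ) :
    NoTableRefutes E K M s t := by
  intro m _ c _ d _ hsat b hb
  have hm : 0 < m := by
    by_contra hm
    obtain rfl : m = 0 := by omega
    simp at hb
  -- The algebra is lifted to the universe of the lattices in `h`.
  let val : ULift.{v} (Fin m) → ℕ := fun x => x.down
  have hval : Function.Injective val := Fin.val_injective.comp ULift.down_injective
  let op : ℕ → ULift.{v} (Fin m) → ULift.{v} (Fin m) → ULift.{v} (Fin m) := fun c x y =>
    ⟨⟨tableOp m c (val x) (val y), Nat.mod_lt _ hm⟩⟩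
  have hfold : ∀ e ∈ E, ∀ a : ℕ → ULift.{v} (Fin m),
      e.1.fold (op c) (op d) a = e.2.fold (op c) (op d) a := by
    intro e he a
    obtain ⟨b, hb, hdig⟩ := exists_digits K fun i => (a i).down
    have key : ∀ u : LatticeTerm ℕ, u.toCode < K →
        val (u.fold (op c) (op d) a) = tableEval m c d b u := fun u hu =>
      map_fold_eq_tableEval val (fun _ _ => rfl) (fun _ _ => rfl) fun x hx =>
        hdig x (lt_of_le_of_lt hx hu)
    exact hval ((key _ (hK e he).1).trans ((hsat e he b hb).trans (key _ (hK e he).2).symm))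
  obtain ⟨_, hsup, hinf⟩ := exists_lattice_of_latticeIdentities (op c) (op d)
    fun e he => hfold e (hE he)
  let a : X → ULift.{v} (Fin m) := fun x => ⟨⟨b / m ^ Encodable.encode x % m, Nat.mod_lt _ hm⟩⟩
  have hst := h _ (fun e he a => by
    rw [LatticeTerm.eval_eq_fold hsup hinf, LatticeTerm.eval_eq_fold hsup hinf, hfold e he]) a
  rw [LatticeTerm.eval_eq_fold hsup hinf, LatticeTerm.eval_eq_fold hsup hinf] at hst
  have key : ∀ u : LatticeTerm X, val (u.fold (op c) (op d) a) = tableEval m c d b u :=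
    fun u => map_fold_eq_tableEval val (fun _ _ => rfl) (fun _ _ => rfl) fun _ _ => rfl
  rw [← key, ← key, hst]

/-- The procedure searches all tables up to the size given by `witnessBound` for a refutation. -/
theorem decidableWordProblem (n : ℕ) (hn : 0 < n) (X : Type v) [Primcodable X] :
    DecidableWordProblem n hn X := by
  classical
  obtain ⟨e, he⟩ := exists_identity_isNDistributive.{v} n hn
  obtain ⟨K, hK⟩ : ∃ K, ∀ e' ∈ e :: latticeIdentities, e'.1.toCode < K ∧ e'.2.toCode < K := by
    obtain ⟨K, hK⟩ := ((e :: latticeIdentities).toFinset.image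
      fun e' => e'.1.toCode + e'.2.toCode).bddAbove
    refine ⟨K + 1, fun e' he' => ?_⟩
    have : e'.1.toCode + e'.2.toCode ≤ K :=
      hK (Finset.mem_coe.2 (Finset.mem_image_of_mem _ (List.mem_toFinset.2 he')))
    omega
  let M : LatticeTerm X × LatticeTerm X → ℕ := fun p =>
    2 ^ witnessBound n p.1 + 2 ^ witnessBound n p.2
  have hM : Primrec M := by
    have h2 : ∀ {f : LatticeTerm X × LatticeTerm X → LatticeTerm X}, Primrec f →
        Primrec fun p => 2 ^ witnessBound n (f p) := fun hf =>
      Primrec.nat_pow.comp (Primrec.const 2) ((primrec_witnessBound n).comp hf)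
    exact Primrec.nat_add.comp (h2 Primrec.fst) (h2 Primrec.snd)
  have hE : ∀ (L : Type v) [Lattice L], (∀ e' ∈ e :: latticeIdentities,
      SatisfiesIdentity L e'.1 e'.2) ↔ IsNDistributive n hn L := fun L _ => by
    rw [he, List.forall_mem_cons]
    exact and_iff_left fun e' => satisfiesIdentity_of_mem_latticeIdentities L
  refine (primrecPred_noTableRefutes (e :: latticeIdentities) K hM).computablePred.of_eq
    fun ⟨s, t⟩ => ?_
  rw [FreeNDistrLattice.eval_of, FreeNDistrLattice.eval_of, FreeNDistrLattice.mk_eq_mk]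
  refine ⟨fun h L _ hL a => ?_, fun h => noTableRefutes_of_forall_eval_eq hK
    (List.subset_cons_self _ _) (fun L _ hL => h L ((hE L).1 hL)) _⟩
  have hlt := fun u : LatticeTerm X => (Nat.two_pow_pos (witnessBound n u))
  by_contra hne
  obtain hst | hts : ¬ s.eval a ≤ t.eval a ∨ ¬ t.eval a ≤ s.eval a := by
    by_contra! hle
    exact hne (le_antisymm hle.1 hle.2)
  · obtain ⟨C, _, _, hcard, hC, z, hz⟩ := hL.exists_finite_refutation a hst
    exact hz (eval_eq_of_noTableRefutes h
      (hcard.trans_lt (Nat.lt_add_of_pos_right (hlt t))) ((hE C).2 hC) z).le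
  · obtain ⟨C, _, _, hcard, hC, z, hz⟩ := hL.exists_finite_refutation a hts
    exact hz (eval_eq_of_noTableRefutes h
      (hcard.trans_lt (Nat.lt_add_of_pos_left (hlt s))) ((hE C).2 hC) z).ge

theorem theoremT (n : ℕ) (hn : 0 < n) :
    IsVarietyGeneratedBy.{u} (fun L [Lattice L] => IsNDistributive n hn L)
        (fun L [Lattice L] => Finite L ∧ IsNDistributive n hn L) ∧
      ∀ (X : Type v) [Primcodable X], DecidableWordProblem n hn X :=
  ⟨isVarietyGeneratedBy_finite n hn, fun X _ => decidableWordProblem n hn X⟩
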